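/- Call a group just infinite if it is infinite and every quotient of it by a nontrivial normal subgroup is finite, and call a group $S$ a section of a group $Q$ if $S$ is (isomorphic to) a quotient of a subgroup of $Q$. There exists a finitely generated periodic just infinite group $Q$ such that: (1) the order of every element of $Q$ is square-free; (2) every section of $Q$ is residually finite; in particular, $Q$ is residually finite; (3) if $S$ is a finite section of $Q$, then $S$ is solvable and all Sylow subgroups of $S$ are abelian; moreover, every (finite or infinite) nilpotent section of $Q$ is abelian. -/

import Mathlib

/-- A group is just infinite if it is infinite and all its proper quotients (the quotients by
nontrivial normal subgroups) are finite. -/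
def IsJustInfinite (G : Type*) [Group G] : Prop :=
  Infinite G ∧ ∀ N : Subgroup G, N.Normal → N ≠ ⊥ → Finite (G ⧸ N)

/-- `S` is a section of `G` if it is (isomorphic to) a quotient of a subgroup of `G`, that is, a
homomorphic image of a subgroup of `G`. -/
def IsSection (S G : Type*) [Group S] [Group G] : Prop :=
  ∃ (H : Subgroup G) (f : H →* S), Function.Surjective f

/-!
The group is obtained from an infinite finitely generated torsion group with a descending series of
normal subgroups, with trivial intersection, whose `i`-th factor is elementary abelian for the
`i`-th prime. Because the primes are distinct, such a series controls all sections
(`IsPrimeSeries`): elements of its `i`-th term have square-free orders prime to the first `i`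
primes. This property passes to homomorphic images of subgroups and forces the intersection of the
image series to be trivial again, whence residual finiteness. A `p`-subgroup embeds into the single
factor that belongs to `p`, so it is abelian, and nilpotent sections are abelian because they are
residually finite and their finite quotients are products of their Sylow subgroups. A finitely
generated infinite group has a just infinite quotient (`exists_normal_isJustInfinite_quotient`), and
quotients are sections.

The torsion group is the quotient of the free group `F` of rank two by the intersection of a
strictly decreasing tower of normal subgroups of finite index (`exists_infinite_isPrimeSeries`). Let
`r` enumerate `F`. Given a term `K` of index `j` and a prime `p`, the quotient of `K` by the next
term is the quotient of the homology of `K` modulo `p` by the relations `r n ^ m = 1`, one for each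
`n` such that the order `m` of `r n` modulo `K` is at least `2 ^ (n + 2)`. Hence that order never
grows again once it has reached `2 ^ (n + 2)`, and every element of the quotient has finite order.
The tower is strictly decreasing by a count: the homology of `K` modulo `p` has dimension at least
`2 * j - j`, while a relation and its conjugates span a space of dimension at most `j / m`, because
conjugating `r n ^ m` by `K` or by `r n` does not change its class; in total the relations account
for at most `∑ j / 2 ^ (n + 2) ≤ j / 2` dimensions. The homology is handled concretely, by the
chains of paths in the Cayley graph of `F ⧸ K` (`cayleyChain`).
-/

open scoped commutatorElement

/-! ### Chains in Cayley graphs -/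

section CayleyChain

variable {α X : Type*} [Group X] (k : Type*) [Field k] (φ : FreeGroup α →* X)

/-- For `φ : FreeGroup α →* X`, regard `X` as the vertex set of a graph with an edge `(x, a)` from
`x` to `(φ a)⁻¹ * x` for all `x : X` and `a : α`. This homomorphism into a wreath product sends `g`
to the pair of the function `x ↦` (the 1-chain, with coefficients in `k`, of the path from `x`
spelled by `g`) and the element `φ g`. -/
noncomputable def cayleyChainHom : FreeGroup α →* Multiplicative (X × α →₀ k) ≀ᵣ X :=
  FreeGroup.lift fun a =>
    ⟨fun x => Multiplicative.ofAdd (Finsupp.single (x, a) 1), φ (FreeGroup.of a)⟩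

/-- The 1-chain of the path from `x` to `(φ g)⁻¹ * x` spelled by `g` in the graph of
`cayleyChainHom`. -/
noncomputable def cayleyChain (g : FreeGroup α) (x : X) : X × α →₀ k :=
  Multiplicative.toAdd ((cayleyChainHom k φ g).left x)

theorem cayleyChainHom_right (g : FreeGroup α) : (cayleyChainHom k φ g).right = φ g := by
  have : RegularWreathProduct.rightHom.comp (cayleyChainHom k φ) = φ := by
    ext a
    simp [cayleyChainHom]
  exact DFunLike.congr_fun this g

theorem cayleyChain_of (a : α) (x : X) :
    cayleyChain k φ (FreeGroup.of a) x = Finsupp.single (x, a) 1 := by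
  simp [cayleyChain, cayleyChainHom]

theorem cayleyChain_one (x : X) : cayleyChain k φ 1 x = 0 := by
  simp [cayleyChain]

theorem cayleyChain_mul (g h : FreeGroup α) (x : X) :
    cayleyChain k φ (g * h) x = cayleyChain k φ g x + cayleyChain k φ h ((φ g)⁻¹ * x) := by
  simp [cayleyChain, cayleyChainHom_right]

variable {φ}

theorem cayleyChain_mul_of_ker {g : FreeGroup α} (hg : φ g = 1) (h : FreeGroup α) (x : X) :
    cayleyChain k φ (g * h) x = cayleyChain k φ g x + cayleyChain k φ h x := by
  simp [cayleyChain_mul, hg]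

theorem cayleyChain_inv_of_ker {g : FreeGroup α} (hg : φ g = 1) (x : X) :
    cayleyChain k φ g⁻¹ x = -cayleyChain k φ g x := by
  rw [eq_neg_iff_add_eq_zero, add_comm, ← cayleyChain_mul_of_ker k hg, mul_inv_cancel,
    cayleyChain_one]

theorem cayleyChain_pow_of_ker {g : FreeGroup α} (hg : φ g = 1) (n : ℕ) (x : X) :
    cayleyChain k φ (g ^ n) x = n • cayleyChain k φ g x := by
  induction n with
  | zero => simp [cayleyChain_one]
  | succ n ih => rw [pow_succ', cayleyChain_mul_of_ker k hg, ih, succ_nsmul']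

theorem cayleyChain_conj_of_ker {g : FreeGroup α} (hg : φ g = 1) (t : FreeGroup α) (x : X) :
    cayleyChain k φ (t * g * t⁻¹) x = cayleyChain k φ g ((φ t)⁻¹ * x) := by
  have h := cayleyChain_mul k φ (t * g * t⁻¹) t x
  rw [inv_mul_cancel_right, cayleyChain_mul] at h
  simp only [map_mul, hg, mul_one, map_inv, mul_inv_cancel, inv_one, one_mul] at h
  rw [add_comm] at h
  exact (add_right_cancel h).symm

/-- A subspace of the 1-chains that contains the chains of all closed paths has codimension at most
`Nat.card X`: modulo such a subspace every edge is a difference of two chains of paths from `1`,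
which depend only on their end point. -/
theorem exists_cayleyChain_notMem [Finite X] [Fintype α] (hφ : Function.Surjective φ)
    (U : Submodule k (X × α →₀ k))
    (hU : Module.finrank k U + Nat.card X < Nat.card X * Fintype.card α) :
    ∃ g, φ g = 1 ∧ ∃ x, cayleyChain k φ g x ∉ U := by
  have := Fintype.ofFinite X
  by_contra! H
  obtain ⟨s, hs⟩ := hφ.hasRightInverse
  let e : X → (X × α →₀ k) := fun y => cayleyChain k φ (s y⁻¹) 1
  -- Modulo `U`, the chain of a path depends only on its end points.
  have key (g h : FreeGroup α) (hgh : φ g = φ h) (x : X) :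
      cayleyChain k φ g x - cayleyChain k φ h x ∈ U := by
    have h1 : φ (g * h⁻¹) = 1 := by simp [hgh]
    have h2 := cayleyChain_mul_of_ker k h1 h x
    rw [inv_mul_cancel_right] at h2
    rw [h2, add_sub_cancel_right]
    exact H _ h1 x
  have htop : (⊤ : Submodule k (X × α →₀ k)) ≤ U ⊔ Submodule.span k (Set.range e) := by
    rw [← Finsupp.basisSingleOne.span_eq, Submodule.span_le]
    rintro _ ⟨⟨x, a⟩, rfl⟩
    have h1 := key (s ((φ (FreeGroup.of a))⁻¹ * x)⁻¹) (s x⁻¹ * FreeGroup.of a)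
      (by simp [hs _]) 1
    rw [cayleyChain_mul, hs, inv_inv, mul_one, cayleyChain_of] at h1
    have h2 (y : X) : e y ∈ U ⊔ Submodule.span k (Set.range e) :=
      Submodule.mem_sup_right (Submodule.subset_span ⟨y, rfl⟩)
    have h3 := sub_mem (sub_mem (h2 ((φ (FreeGroup.of a))⁻¹ * x)) (h2 x))
      (Submodule.mem_sup_left h1)
    simpa [e] using h3
  have h1 := Submodule.finrank_mono htop
  have h2 := Submodule.finrank_add_le_finrank_add_finrank U (Submodule.span k (Set.range e))
  have h3 := finrank_range_le_card (R := k) e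
  rw [finrank_top, Module.finrank_finsupp_self, Fintype.card_prod] at h1
  rw [Set.finrank] at h3
  simp only [Nat.card_eq_fintype_card] at hU
  lia

/-- If `φ g` has order `m`, then the closed paths spelled by `g ^ m` have at most `Nat.card X / m`
distinct chains, one for each orbit of `φ g`. -/
theorem finrank_span_cayleyChain_pow_orderOf_mul_le [Finite X] [Finite α] (g : FreeGroup α) :
    Module.finrank k (Submodule.span k (Set.range (cayleyChain k φ (g ^ orderOf (φ g))))) *
      orderOf (φ g) ≤ Nat.card X := by
  have := Fintype.ofFinite X
  have hker : φ (g ^ orderOf (φ g)) = 1 := by simp [pow_orderOf_eq_one]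
  set w := g ^ orderOf (φ g) with hw
  let Z := Subgroup.zpowers (φ g)
  have hstep (x : X) : cayleyChain k φ w ((φ g)⁻¹ * x) = cayleyChain k φ w x := by
    rw [← cayleyChain_conj_of_ker k hker, hw, ← pow_succ', pow_succ, mul_inv_cancel_right]
  have hZ (z : X) (hz : z ∈ Z) (x : X) :
      cayleyChain k φ w (z⁻¹ * x) = cayleyChain k φ w x := by
    obtain ⟨n, rfl⟩ := mem_powers_iff_mem_zpowers.2 hz
    induction n with
    | zero => simp
    | succ n ih =>
      simp only [pow_succ, mul_inv_rev, mul_assoc] at ih ⊢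
      rw [hstep]
      exact ih (Subgroup.npow_mem_zpowers _ _)
  let b : X ⧸ Z → (X × α →₀ k) := Quotient.lift (fun x => cayleyChain k φ w x⁻¹) (by
    intro x y hxy
    have := hZ _ (QuotientGroup.leftRel_apply.1 hxy) x⁻¹
    simpa using this.symm)
  have hb : Set.range (cayleyChain k φ w) ⊆ Set.range b := by
    rintro _ ⟨x, rfl⟩
    exact ⟨QuotientGroup.mk x⁻¹, congrArg (cayleyChain k φ w) (inv_inv x)⟩
  have := Fintype.ofFinite (X ⧸ Z)
  have := FiniteDimensional.span_of_finite k (Set.finite_range b)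
  calc _ ≤ Fintype.card (X ⧸ Z) * orderOf (φ g) :=
        Nat.mul_le_mul_right _ ((Submodule.finrank_mono (Submodule.span_mono hb)).trans
          (finrank_range_le_card (R := k) b))
    _ = Nat.card X := by
        rw [← Nat.card_zpowers, ← Nat.card_eq_fintype_card,
          ← Subgroup.card_eq_card_quotient_mul_card_subgroup]

end CayleyChain

/-! ### One step of the tower of subgroups -/

theorem Submodule.finrank_finset_sup_le {ι k V : Type*} [Field k] [AddCommGroup V] [Module k V]
    [FiniteDimensional k V] (s : Finset ι) (f : ι → Submodule k V) :
    Module.finrank k (s.sup f : Submodule k V) ≤ ∑ i ∈ s, Module.finrank k (f i) := by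
  classical
  induction s using Finset.induction_on with
  | empty => simp
  | insert a s ha ih =>
    rw [Finset.sup_insert, Finset.sum_insert ha]
    exact (Submodule.finrank_add_le_finrank_add_finrank _ _).trans (Nat.add_le_add_left ih _)

/-- Let `K` be a normal subgroup of finite index of the free group of rank two, and `r` a sequence
of elements. A proper subgroup `K'` of `K` can be chosen so that `K / K'` is elementary abelian of
exponent `p` and, whenever the order `m` of `r n` modulo `K` is at least `2 ^ (n + 2)`, the power
`r n ^ m` lies in `K'`. These powers impose few linear conditions, by
`finrank_span_cayleyChain_pow_orderOf_mul_le`, so `exists_cayleyChain_notMem` shows `K' ≠ K`. -/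
theorem exists_lt_normal_pow_orderOf_mem (K : Subgroup (FreeGroup Bool)) (hK : K.Normal)
    (hfin : K.FiniteIndex) (p : ℕ) (hp : p.Prime) (r : ℕ → FreeGroup Bool) :
    ∃ K' : Subgroup (FreeGroup Bool), (K'.Normal ∧ K'.FiniteIndex) ∧ K' < K ∧
      (∀ x ∈ K, x ^ p ∈ K') ∧ (∀ x ∈ K, ∀ y ∈ K, ⁅x, y⁆ ∈ K') ∧
      ∀ n, 2 ^ (n + 2) ≤ orderOf (QuotientGroup.mk' K (r n)) →
        r n ^ orderOf (QuotientGroup.mk' K (r n)) ∈ K' := by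
  have : Fact p.Prime := ⟨hp⟩
  set φ := QuotientGroup.mk' K
  have hφ : Function.Surjective φ := QuotientGroup.mk'_surjective K
  have hker (g : FreeGroup Bool) : φ g = 1 ↔ g ∈ K := QuotientGroup.eq_one_iff g
  let J := Nat.card (FreeGroup Bool ⧸ K)
  have hJ : 0 < J := Nat.card_pos
  let W : ℕ → Submodule (ZMod p) ((FreeGroup Bool ⧸ K) × Bool →₀ ZMod p) := fun n =>
    Submodule.span _ (Set.range (cayleyChain (ZMod p) φ (r n ^ orderOf (φ (r n)))))
  let T := (Finset.range J).filter fun n => 2 ^ (n + 2) ≤ orderOf (φ (r n))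
  let U := T.sup W
  have hT (n : ℕ) (hn : 2 ^ (n + 2) ≤ orderOf (φ (r n))) : n ∈ T := by
    simp only [T, Finset.mem_filter, Finset.mem_range]
    refine ⟨?_, hn⟩
    calc n < 2 ^ n := Nat.lt_two_pow_self
      _ ≤ 2 ^ (n + 2) := Nat.pow_le_pow_right two_pos (by lia)
      _ ≤ J := hn.trans (Nat.le_of_dvd hJ (orderOf_dvd_natCard _))
  have hW (n : ℕ) (hn : n ∈ T) :
      (Module.finrank (ZMod p) (W n) : ℚ) ≤ J * (1 / 2) ^ (n + 2) := by
    have h1 := finrank_span_cayleyChain_pow_orderOf_mul_le (ZMod p) (φ := φ) (r n)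
    have h2 := (Nat.mul_le_mul_left (Module.finrank (ZMod p) (W n))
      (Finset.mem_filter.1 hn).2).trans h1
    have h3 : (Module.finrank (ZMod p) (W n) : ℚ) * 2 ^ (n + 2) ≤ J := by exact_mod_cast h2
    rw [one_div, inv_pow, ← div_eq_mul_inv, le_div_iff₀ (by positivity)]
    exact h3
  have hgeom (N : ℕ) :
      ∑ n ∈ Finset.range N, (1 / 2 : ℚ) ^ (n + 2) = 1 / 2 - (1 / 2) ^ (N + 1) := by
    induction N with
    | zero => norm_num
    | succ N ih => rw [Finset.sum_range_succ, ih]; ring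
  have hU : (Module.finrank (ZMod p) U : ℚ) ≤ J * (1 / 2) := by
    calc (Module.finrank (ZMod p) U : ℚ) ≤ ∑ n ∈ T, (Module.finrank (ZMod p) (W n) : ℚ) := by
          exact_mod_cast Submodule.finrank_finset_sup_le T W
      _ ≤ ∑ n ∈ T, (J : ℚ) * (1 / 2) ^ (n + 2) := Finset.sum_le_sum hW
      _ ≤ ∑ n ∈ Finset.range J, (J : ℚ) * (1 / 2) ^ (n + 2) :=
          Finset.sum_le_sum_of_subset_of_nonneg (Finset.filter_subset _ _)
            fun _ _ _ => by positivity
      _ ≤ J * (1 / 2) := by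
          rw [← Finset.mul_sum, hgeom]
          have : (0 : ℚ) ≤ (1 / 2) ^ (J + 1) := by positivity
          gcongr
          linarith
  have hU2 : 2 * Module.finrank (ZMod p) U ≤ J := by
    have : (2 * Module.finrank (ZMod p) U : ℚ) ≤ J := by linarith
    exact_mod_cast this
  let K' : Subgroup (FreeGroup Bool) :=
    { carrier := {g | φ g = 1 ∧ ∀ x, cayleyChain (ZMod p) φ g x ∈ U}
      one_mem' := ⟨map_one φ, fun x => by rw [cayleyChain_one]; exact U.zero_mem⟩
      mul_mem' := fun {a b} ha hb => ⟨by rw [map_mul, ha.1, hb.1, one_mul], fun x => by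
        rw [cayleyChain_mul_of_ker _ ha.1]; exact U.add_mem (ha.2 x) (hb.2 x)⟩
      inv_mem' := fun {a} ha => ⟨by rw [map_inv, ha.1, inv_one], fun x => by
        rw [cayleyChain_inv_of_ker _ ha.1]; exact U.neg_mem (ha.2 x)⟩ }
  have hK' (g : FreeGroup Bool) :
      g ∈ K' ↔ φ g = 1 ∧ ∀ x, cayleyChain (ZMod p) φ g x ∈ U := Iff.rfl
  refine ⟨K', ⟨⟨fun g hg t => ?_⟩, ?_⟩, ?_, fun x hx => ?_, fun x hx y hy => ?_, fun n hn => ?_⟩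
  · refine ⟨by rw [map_mul, map_mul, hg.1, mul_one, map_inv, mul_inv_cancel], fun x => ?_⟩
    rw [cayleyChain_conj_of_ker _ hg.1]
    exact hg.2 _
  · have : Finite ((FreeGroup Bool ⧸ K) × Bool →₀ ZMod p) := Module.finite_of_finite (ZMod p)
    have : Finite (Multiplicative ((FreeGroup Bool ⧸ K) × Bool →₀ ZMod p)) := this
    refine Subgroup.finiteIndex_of_le (H := (cayleyChainHom (ZMod p) φ).ker) fun g hg => ?_
    rw [MonoidHom.mem_ker] at hg
    refine ⟨by rw [← cayleyChainHom_right (ZMod p), hg, RegularWreathProduct.one_right],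
      fun x => ?_⟩
    rw [cayleyChain, hg]
    exact U.zero_mem
  · refine lt_of_le_of_ne (fun g hg => (hker g).1 hg.1) fun heq => ?_
    obtain ⟨g, hg, x, hx⟩ := exists_cayleyChain_notMem (ZMod p) hφ U (by
      rw [Fintype.card_bool]
      change _ + J < J * 2
      lia)
    rw [hker, ← heq] at hg
    exact hx (hg.2 x)
  · rw [← hker] at hx
    refine ⟨by rw [map_pow, hx, one_pow], fun y => ?_⟩
    rw [cayleyChain_pow_of_ker _ hx, ← Nat.cast_smul_eq_nsmul (ZMod p), CharP.cast_eq_zero,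
      zero_smul]
    exact U.zero_mem
  · rw [← hker] at hx hy
    have hx' : φ x⁻¹ = 1 := by rw [map_inv, hx, inv_one]
    have hxy : φ (x * y) = 1 := by rw [map_mul, hx, hy, one_mul]
    have hxyx : φ (x * y * x⁻¹) = 1 := by rw [map_mul, hxy, hx', one_mul]
    refine ⟨by rw [map_commutatorElement, hx, hy, commutatorElement_self], fun z => ?_⟩
    rw [commutatorElement_def, cayleyChain_mul_of_ker _ hxyx, cayleyChain_mul_of_ker _ hxy,
      cayleyChain_mul_of_ker _ hx, cayleyChain_inv_of_ker _ hx, cayleyChain_inv_of_ker _ hy]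
    convert U.zero_mem using 1
    abel
  · refine ⟨by rw [map_pow, pow_orderOf_eq_one], fun x => ?_⟩
    exact Finset.le_sup (f := W) (hT n hn) (Submodule.subset_span ⟨x, rfl⟩)

/-! ### Series with elementary abelian factors for distinct primes -/

/-- A descending series of normal subgroups of finite index, starting at the whole group, whose
`i`-th factor is an elementary abelian `p`-group for the `i`-th prime `p` (counting from zero). The
last condition says that the elements of `K i` are torsion with orders that divide products of
distinct primes from the `i`-th one on; unlike `⨅ i, K i = ⊥`, it visibly passes to homomorphic
images. -/
structure IsPrimeSeries {G : Type*} [Group G] (K : ℕ → Subgroup G) : Prop where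
  normal : ∀ i, (K i).Normal
  finiteIndex : ∀ i, (K i).FiniteIndex
  zero_eq : K 0 = ⊤
  succ_le : ∀ i, K (i + 1) ≤ K i
  pow_mem : ∀ i, ∀ x ∈ K i, x ^ Nat.nth Nat.Prime i ∈ K (i + 1)
  commutator_mem : ∀ i, ∀ x ∈ K i, ∀ y ∈ K i, ⁅x, y⁆ ∈ K (i + 1)
  exists_pow_eq_one : ∀ i, ∀ x ∈ K i, ∃ k, x ^ ∏ j ∈ Finset.Ico i k, Nat.nth Nat.Prime j = 1

theorem Nat.Coprime.of_nth_prime {i j : ℕ} (h : i ≠ j) :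
    (Nat.nth Nat.Prime i).Coprime (Nat.nth Nat.Prime j) :=
  (Nat.coprime_primes (Nat.prime_nth_prime i) (Nat.prime_nth_prime j)).2
    ((Nat.nth_injective Nat.infinite_setOfPred_prime).ne h)

theorem isSection_quotient {G : Type*} [Group G] (N : Subgroup G) [N.Normal] :
    IsSection (G ⧸ N) G :=
  ⟨⊤, (QuotientGroup.mk' N).comp (⊤ : Subgroup G).subtype,
    (QuotientGroup.mk'_surjective N).comp fun x => ⟨⟨x, trivial⟩, rfl⟩⟩

namespace IsPrimeSeries

variable {G : Type*} [Group G] {K : ℕ → Subgroup G}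

theorem antitone (hK : IsPrimeSeries K) : Antitone K :=
  antitone_nat_of_succ_le hK.succ_le

theorem exists_orderOf_dvd (hK : IsPrimeSeries K) (x : G) :
    ∃ k, orderOf x ∣ ∏ j ∈ Finset.range k, Nat.nth Nat.Prime j := by
  obtain ⟨k, hk⟩ := hK.exists_pow_eq_one 0 x (by simp [hK.zero_eq])
  exact ⟨k, orderOf_dvd_of_pow_eq_one (by rwa [Finset.range_eq_Ico])⟩

theorem isMulTorsion (hK : IsPrimeSeries K) : IsMulTorsion G := fun x => by
  obtain ⟨k, hk⟩ := hK.exists_orderOf_dvd x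
  exact orderOf_pos_iff.1 (Nat.pos_of_dvd_of_pos hk
    (Finset.prod_pos fun j _ => (Nat.prime_nth_prime j).pos))

theorem squarefree_orderOf (hK : IsPrimeSeries K) (x : G) : Squarefree (orderOf x) := by
  obtain ⟨k, hk⟩ := hK.exists_orderOf_dvd x
  refine Squarefree.squarefree_of_dvd hk
    (Finset.squarefree_prod_of_pairwise_isCoprime (fun i _ j _ hij => ?_)
      fun i _ => (Nat.prime_nth_prime i).squarefree)
  exact Nat.coprime_iff_isRelPrime.1 (Nat.Coprime.of_nth_prime hij)

theorem coprime_orderOf (hK : IsPrimeSeries K) {i j : ℕ} (hij : i < j) {x : G} (hx : x ∈ K j) :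
    (Nat.nth Nat.Prime i).Coprime (orderOf x) := by
  obtain ⟨k, hk⟩ := hK.exists_pow_eq_one j x hx
  refine Nat.Coprime.coprime_dvd_right (orderOf_dvd_of_pow_eq_one hk)
    (Nat.Coprime.prod_right fun l hl => Nat.Coprime.of_nth_prime ?_)
  have := (Finset.mem_Ico.1 hl).1
  lia

theorem eq_one_of_forall_mem (hK : IsPrimeSeries K) {x : G} (hx : ∀ i, x ∈ K i) : x = 1 := by
  obtain ⟨k, hk⟩ := hK.exists_orderOf_dvd x
  rw [← orderOf_eq_one_iff]
  exact Nat.Coprime.eq_one_of_dvd (Nat.Coprime.symm (Nat.Coprime.prod_left fun i _ =>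
    hK.coprime_orderOf (Nat.lt_succ_self i) (hx (i + 1)))) hk

theorem residuallyFinite (hK : IsPrimeSeries K) : Group.ResiduallyFinite G := by
  rw [Group.residuallyFinite_iff_forall_finiteIndexNormalSubgroup]
  refine fun g hg => hK.eq_one_of_forall_mem fun i => ?_
  exact hg ⟨K i, hK.normal i, hK.finiteIndex i⟩

/-- The images of the terms of a prime series form a prime series in every section. -/
theorem of_surjective (hK : IsPrimeSeries K) {H : Subgroup G} {S : Type*} [Group S] {f : H →* S}
    (hf : Function.Surjective f) : IsPrimeSeries fun i => ((K i).subgroupOf H).map f where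
  normal i := by
    have := hK.normal i
    exact Subgroup.Normal.map inferInstance f hf
  finiteIndex i := by
    have := hK.finiteIndex i
    have h1 := Subgroup.index_map_dvd ((K i).subgroupOf H) hf
    exact ⟨fun h0 => Subgroup.FiniteIndex.index_ne_zero (Nat.eq_zero_of_zero_dvd (h0 ▸ h1))⟩
  zero_eq := by
    rw [hK.zero_eq, Subgroup.top_subgroupOf, Subgroup.map_top_of_surjective f hf]
  succ_le i := Subgroup.map_mono (Subgroup.comap_mono (hK.succ_le i))
  pow_mem := by
    rintro i _ ⟨x, hx, rfl⟩
    exact ⟨x ^ Nat.nth Nat.Prime i, hK.pow_mem i x hx, map_pow f x _⟩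
  commutator_mem := by
    rintro i _ ⟨x, hx, rfl⟩ _ ⟨y, hy, rfl⟩
    exact ⟨⁅x, y⁆, hK.commutator_mem i x hx y hy, map_commutatorElement f x y⟩
  exists_pow_eq_one := by
    rintro i _ ⟨x, hx, rfl⟩
    obtain ⟨k, hk⟩ := hK.exists_pow_eq_one i x hx
    refine ⟨k, ?_⟩
    rw [← map_pow, show x ^ _ = 1 from Subtype.ext hk, map_one]

theorem exists_of_isSection (hK : IsPrimeSeries K) {S : Type*} [Group S] (hS : IsSection S G) :
    ∃ L : ℕ → Subgroup S, IsPrimeSeries L := by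
  obtain ⟨H, f, hf⟩ := hS
  exact ⟨_, hK.of_surjective hf⟩

theorem derivedSeries_le (hK : IsPrimeSeries K) (i : ℕ) : derivedSeries G i ≤ K i := by
  induction i with
  | zero => simp [hK.zero_eq]
  | succ i ih =>
    rw [derivedSeries_succ, Subgroup.commutator_le]
    exact fun x hx y hy => hK.commutator_mem i x (ih hx) y (ih hy)

theorem isSolvable [Finite G] (hK : IsPrimeSeries K) : Group.IsSolvable G := by
  have h (x : G) : ∃ i, x ≠ 1 → x ∉ K i := by
    by_contra! h
    exact (h 0).1 (hK.eq_one_of_forall_mem fun i => (h i).2)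
  choose i hi using h
  obtain ⟨k, hk⟩ := (Set.finite_range i).bddAbove
  refine ⟨k, (Subgroup.eq_bot_iff_forall _).2 fun x hx => ?_⟩
  by_contra hx1
  exact hi x hx1 (hK.antitone (hk ⟨x, rfl⟩) (hK.derivedSeries_le k hx))

/-- Elements of order `p` cannot be told from `1` by the factors that belong to other primes. -/
theorem mem_of_pow_eq_one (hK : IsPrimeSeries K) {i : ℕ} {x : G}
    (hx : x ^ Nat.nth Nat.Prime i = 1) : ∀ j ≤ i, x ∈ K j := by
  intro j hj
  induction j with
  | zero => simp [hK.zero_eq]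
  | succ j ih =>
    have h := hK.pow_mem j x (ih (by lia))
    have hcop : (orderOf x).Coprime (Nat.nth Nat.Prime j) :=
      Nat.Coprime.coprime_dvd_left (orderOf_dvd_of_pow_eq_one hx)
        (Nat.Coprime.of_nth_prime (by lia))
    obtain ⟨m, hm⟩ := exists_pow_eq_self_of_coprime hcop.symm
    rw [← hm]
    exact (K (j + 1)).pow_mem h m

/-- A `p`-subgroup, where `p` is the `i`-th prime, is contained in `K i` and meets `K (i + 1)`
trivially. -/
theorem commute_of_isPGroup (hK : IsPrimeSeries K) {p : ℕ} (hp : p.Prime) {P : Subgroup G}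
    (hP : IsPGroup p P) {a b : G} (ha : a ∈ P) (hb : b ∈ P) : a * b = b * a := by
  obtain ⟨i, rfl⟩ : ∃ i, Nat.nth Nat.Prime i = p := ⟨_, Nat.nth_count hp⟩
  have hpow (x : G) (hx : x ∈ P) : ∃ n, orderOf x ∣ Nat.nth Nat.Prime i ^ n := by
    obtain ⟨n, hn⟩ := hP ⟨x, hx⟩
    exact ⟨n, orderOf_dvd_of_pow_eq_one (congrArg Subtype.val hn)⟩
  have hmem (x : G) (hx : x ∈ P) : x ∈ K i := by
    obtain ⟨n, hn⟩ := hpow x hx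
    refine hK.mem_of_pow_eq_one (orderOf_dvd_iff_pow_eq_one.1 ?_) i le_rfl
    exact (hK.squarefree_orderOf x).isRadical n _ hn
  have hc := hK.commutator_mem i a (hmem a ha) b (hmem b hb)
  obtain ⟨n, hn⟩ := hpow ⁅a, b⁆
    (P.mul_mem (P.mul_mem (P.mul_mem ha hb) (P.inv_mem ha)) (P.inv_mem hb))
  rw [← commutatorElement_eq_one_iff_mul_comm, ← orderOf_eq_one_iff]
  exact Nat.Coprime.eq_one_of_dvd
    ((hK.coprime_orderOf (Nat.lt_succ_self i) hc).pow_left n).symm hn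

theorem commute_of_finite_of_isNilpotent [Finite G] [Group.IsNilpotent G]
    (hK : IsPrimeSeries K) (a b : G) : a * b = b * a := by
  obtain ⟨e⟩ := ((Group.isNilpotent_of_finite_tfae (G := G)).out 0 4).1 ‹_›
  rw [← e.symm.injective.eq_iff, map_mul, map_mul]
  ext p P
  exact hK.commute_of_isPGroup (Nat.prime_of_mem_primeFactors p.2) P.isPGroup'
    (e.symm a p P).2 (e.symm b p P).2

theorem commute_of_isNilpotent [Group.IsNilpotent G] (hK : IsPrimeSeries K) (a b : G) :
    a * b = b * a := by
  rw [← commutatorElement_eq_one_iff_mul_comm]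
  refine hK.eq_one_of_forall_mem fun i => ?_
  have := hK.normal i
  have := hK.finiteIndex i
  obtain ⟨L, hL⟩ := hK.exists_of_isSection (isSection_quotient (K i))
  rw [← QuotientGroup.eq_one_iff]
  exact commutatorElement_eq_one_iff_mul_comm.2
    (hL.commute_of_finite_of_isNilpotent (a : G ⧸ K i) b)

end IsPrimeSeries

/-! ### The infinite torsion group -/

/-- In a torsion group, the torsion condition of `IsPrimeSeries` follows from the trivial
intersection of the series, because a finite cyclic subgroup meets some term trivially. -/
theorem exists_pow_prod_eq_one {G : Type*} [Group G] {K : ℕ → Subgroup G} (hanti : Antitone K)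
    (hpow : ∀ i, ∀ x ∈ K i, x ^ Nat.nth Nat.Prime i ∈ K (i + 1)) (hinf : ⨅ i, K i = ⊥)
    (htor : IsMulTorsion G) (i : ℕ) (x : G) (hx : x ∈ K i) :
    ∃ k, x ^ ∏ j ∈ Finset.Ico i k, Nat.nth Nat.Prime j = 1 := by
  have hmem (k : ℕ) : x ^ ∏ j ∈ Finset.Ico i (i + k), Nat.nth Nat.Prime j ∈ K (i + k) := by
    induction k with
    | zero => simpa using hx
    | succ k ih =>
      rw [← add_assoc, Finset.prod_Ico_succ_top (by lia), pow_mul]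
      exact hpow _ _ ih
  have h (y : G) : ∃ k, y ≠ 1 → y ∉ K k := by
    by_contra! h
    refine (h 0).1 ?_
    rw [← Subgroup.mem_bot, ← hinf, Subgroup.mem_iInf]
    exact fun k => (h k).2
  choose m hm using h
  have hfin : (Subgroup.zpowers x : Set G).Finite := finite_zpowers.2 (htor x)
  obtain ⟨k, hk⟩ := (hfin.image m).bddAbove
  refine ⟨i + k, ?_⟩
  by_contra hne
  refine hm _ hne (hanti ?_ (hmem k))
  exact (hk ⟨_, Subgroup.npow_mem_zpowers x _, rfl⟩).trans (Nat.le_add_left k i)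

/-- The order of `r n` modulo the `i`-th subgroup of the tower is fixed as soon as it reaches
`2 ^ (n + 2)`, so the orders of each element modulo the subgroups are bounded, and their quotient by
the intersection is torsion. -/
theorem exists_infinite_isPrimeSeries :
    ∃ (Q : Type) (_ : Group Q), Group.FG Q ∧ Infinite Q ∧
      ∃ K : ℕ → Subgroup Q, IsPrimeSeries K := by
  obtain ⟨r, hr⟩ := exists_surjective_nat (FreeGroup Bool)
  choose next hnext hlt hpow hcomm hord using
    fun (i : ℕ) (K : {K : Subgroup (FreeGroup Bool) // K.Normal ∧ K.FiniteIndex}) =>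
      exists_lt_normal_pow_orderOf_mem K.1 K.2.1 K.2.2 (Nat.nth Nat.Prime i)
        (Nat.prime_nth_prime i) r
  let A : ℕ → {K : Subgroup (FreeGroup Bool) // K.Normal ∧ K.FiniteIndex} := fun i =>
    Nat.rec ⟨⊤, inferInstance, inferInstance⟩ (fun i K => ⟨next i K, hnext i K⟩) i
  have hA (i : ℕ) : (A (i + 1)).1 = next i (A i) := rfl
  have hnormal (i : ℕ) : (A i).1.Normal := (A i).2.1
  have hfin (i : ℕ) : (A i).1.FiniteIndex := (A i).2.2
  have hstrict : StrictAnti fun i => (A i).1 := strictAnti_nat_of_succ_lt fun i => hlt i (A i)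
  have hanti : Antitone fun i => (A i).1 := hstrict.antitone
  let N : Subgroup (FreeGroup Bool) := ⨅ i, (A i).1
  have hN : N.Normal := Subgroup.normal_iInf_normal hnormal
  have hNle (i : ℕ) : N ≤ (A i).1 := iInf_le _ i
  have htor : IsMulTorsion (FreeGroup Bool ⧸ N) := by
    intro x
    obtain ⟨g, rfl⟩ := QuotientGroup.mk_surjective x
    obtain ⟨n, rfl⟩ := hr g
    suffices h : ∃ m, 0 < m ∧ ∀ i, r n ^ m ∈ (A i).1 by
      obtain ⟨m, hm, h⟩ := h
      refine isOfFinOrder_iff_pow_eq_one.2 ⟨m, hm, ?_⟩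
      rw [← QuotientGroup.mk_pow, QuotientGroup.eq_one_iff, Subgroup.mem_iInf]
      exact h
    let o : ℕ → ℕ := fun i => orderOf (QuotientGroup.mk' (A i).1 (r n))
    have hpos (i : ℕ) : 0 < o i := orderOf_pos _
    have hdvd (i m : ℕ) : o i ∣ m ↔ r n ^ m ∈ (A i).1 := by
      rw [orderOf_dvd_iff_pow_eq_one, ← map_pow]
      exact QuotientGroup.eq_one_iff _
    by_cases h : ∃ j, 2 ^ (n + 2) ≤ o j
    · obtain ⟨j, hj⟩ := h
      have hstab (k : ℕ) : o (j + k) = o j := by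
        induction k with
        | zero => rfl
        | succ k ih =>
          refine Nat.dvd_antisymm ?_ ?_
          · rw [hdvd, ← ih, ← add_assoc, hA]
            exact hord _ _ n (hj.trans_eq ih.symm)
          · rw [hdvd]
            exact hanti (Nat.le_add_right j (k + 1))
              ((hdvd (j + (k + 1)) (o (j + (k + 1)))).1 dvd_rfl)
      refine ⟨o j, hpos j, fun i => hanti (Nat.le_add_left i j) ?_⟩
      rw [← hdvd, hstab]
    · push Not at h
      exact ⟨(2 ^ (n + 2)).factorial, Nat.factorial_pos _, fun i =>
        (hdvd _ _).1 (Nat.dvd_factorial (hpos i) (h i).le)⟩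
  let K : ℕ → Subgroup (FreeGroup Bool ⧸ N) := fun i => (A i).1.map (QuotientGroup.mk' N)
  have hKanti : Antitone K := fun i j hij => Subgroup.map_mono (hanti hij)
  have hKpow (i : ℕ) : ∀ x ∈ K i, x ^ Nat.nth Nat.Prime i ∈ K (i + 1) := by
    rintro _ ⟨g, hg, rfl⟩
    exact ⟨_, hpow i (A i) g hg, map_pow _ _ _⟩
  have hKinf : ⨅ i, K i = ⊥ := by
    refine (Subgroup.eq_bot_iff_forall _).2 fun x hx => ?_
    obtain ⟨g, rfl⟩ := QuotientGroup.mk'_surjective N x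
    rw [Subgroup.mem_iInf] at hx
    refine (QuotientGroup.eq_one_iff g).2 ((Subgroup.mem_iInf).2 fun i => ?_)
    have h : g ∈ (K i).comap (QuotientGroup.mk' N) := hx i
    rwa [Subgroup.comap_map_eq_self (by simpa using hNle i)] at h
  refine ⟨FreeGroup Bool ⧸ N, inferInstance, inferInstance, ?_, K, ?_⟩
  · -- A subgroup of finite index cannot lie in all terms of a strictly decreasing chain.
    by_contra h
    rw [not_infinite_iff_finite] at h
    have : N.FiniteIndex := Subgroup.finiteIndex_of_finite_quotient
    have hmono : StrictMono fun i => (A i).1.index := strictMono_nat_of_lt_succ fun i =>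
      have := hfin (i + 1)
      Subgroup.index_strictAnti (hstrict (Nat.lt_succ_self i))
    have h1 : N.index + 1 ≤ (A (N.index + 1)).1.index := hmono.le_apply
    have h2 := Subgroup.index_antitone (hNle (N.index + 1))
    lia
  · exact
      { normal := fun i => (hnormal i).map _ (QuotientGroup.mk'_surjective N)
        finiteIndex := fun i => ⟨fun h0 => (hfin i).index_ne_zero (Nat.eq_zero_of_zero_dvd
          (h0 ▸ Subgroup.index_map_dvd (A i).1 (QuotientGroup.mk'_surjective N)))⟩
        zero_eq := Subgroup.map_top_of_surjective _ (QuotientGroup.mk'_surjective N)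
        succ_le := fun i => hKanti (Nat.le_succ i)
        pow_mem := hKpow
        commutator_mem := by
          rintro i _ ⟨g, hg, rfl⟩ _ ⟨h, hh, rfl⟩
          exact ⟨_, hcomm i (A i) g hg h hh, map_commutatorElement _ _ _⟩
        exists_pow_eq_one := exists_pow_prod_eq_one hKanti hKpow hKinf htor }

/-! ### Just infinite quotients -/

/-- The normal subgroups of infinite index of a finitely generated group are closed under unions of
chains, since subgroups of finite index are finitely generated. The quotient by a maximal one is
just infinite. -/
theorem exists_normal_isJustInfinite_quotient (G : Type*) [Group G] [Group.FG G] [Infinite G] :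
    ∃ (N : Subgroup G) (_ : N.Normal), IsJustInfinite (G ⧸ N) := by
  obtain ⟨N, -, ⟨hN, hNinf⟩, hmax⟩ := zorn_le_nonempty₀
    {N : Subgroup G | N.Normal ∧ ¬N.FiniteIndex} (fun c hc hchain y hy => by
      have hdir : DirectedOn (· ≤ ·) c := hchain.directedOn
      refine ⟨sSup c, ⟨⟨fun g hg t => ?_⟩, fun hfin => ?_⟩, fun z hz => le_sSup hz⟩
      · rw [Subgroup.mem_sSup_of_directedOn ⟨y, hy⟩ hdir] at hg ⊢
        obtain ⟨s, hs, hgs⟩ := hg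
        exact ⟨s, hs, (hc hs).1.conj_mem g hgs t⟩
      · obtain ⟨S, hS⟩ := (Group.fg_iff_subgroup_fg _).1 (sSup c).fg_of_index_ne_zero
        have hsub : ∃ s ∈ c, (S : Set G) ⊆ s := by
          refine hdir.exists_mem_subset_of_finset_subset_biUnion
            (f := fun s : Subgroup G => (s : Set G)) ⟨y, hy⟩
            fun g hg => ?_
          have : g ∈ sSup c := hS ▸ Subgroup.subset_closure hg
          rw [Subgroup.mem_sSup_of_directedOn ⟨y, hy⟩ hdir] at this
          simpa using this
        obtain ⟨s, hs, hSs⟩ := hsub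
        refine (hc hs).2 (Subgroup.finiteIndex_of_le (H := sSup c) ?_)
        rw [← hS, Subgroup.closure_le]
        exact hSs) ⊥ ⟨inferInstance, fun h => by
          have : Finite (G ⧸ (⊥ : Subgroup G)) := Subgroup.finite_quotient_of_finiteIndex
          exact not_finite_iff_infinite.2 ‹Infinite G›
            (Finite.of_equiv _ (QuotientGroup.quotientBot (G := G)).toEquiv)⟩
  refine ⟨N, hN, ?_, fun M hM hM1 => ?_⟩
  · rw [← not_finite_iff_infinite]
    exact fun h => hNinf Subgroup.finiteIndex_of_finite_quotient
  · by_contra hMinf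
    have hle : N ≤ M.comap (QuotientGroup.mk' N) := fun g hg => by
      rw [Subgroup.mem_comap, show QuotientGroup.mk' N g = 1 from
        (QuotientGroup.eq_one_iff g).2 hg]
      exact M.one_mem
    have hge := hmax (y := M.comap (QuotientGroup.mk' N)) ⟨inferInstance, fun h => hMinf ?_⟩ hle
    · refine hM1 ((Subgroup.eq_bot_iff_forall _).2 fun x hx => ?_)
      obtain ⟨g, rfl⟩ := QuotientGroup.mk'_surjective N x
      exact (QuotientGroup.eq_one_iff g).2 (hge hx)
    · rw [← Subgroup.finiteIndex_iff_finite_quotient, Subgroup.finiteIndex_iff]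
      have h0 := h.index_ne_zero
      rwa [Subgroup.index_comap_of_surjective _ (QuotientGroup.mk'_surjective N)] at h0

theorem corollary3 :
    ∃ (Q : Type) (_ : Group Q),
      Group.FG Q ∧ IsMulTorsion Q ∧ IsJustInfinite Q ∧
      (∀ x : Q, Squarefree (orderOf x)) ∧
      ((∀ (S : Type) [Group S], IsSection S Q → Group.ResiduallyFinite S) ∧
        Group.ResiduallyFinite Q) ∧
      ((∀ (S : Type) [Group S], IsSection S Q → Finite S →
          Group.IsSolvable S ∧
            ∀ (p : ℕ), p.Prime → ∀ (P : Sylow p S), ∀ a ∈ P, ∀ b ∈ P, a * b = b * a) ∧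
        (∀ (S : Type) [Group S], IsSection S Q → Group.IsNilpotent S →
          ∀ a b : S, a * b = b * a)) := by
  obtain ⟨Q₀, _, hfg, hinf, K₀, hK₀⟩ := exists_infinite_isPrimeSeries
  obtain ⟨N, hN, hji⟩ := exists_normal_isJustInfinite_quotient Q₀
  obtain ⟨K, hK⟩ : ∃ K : ℕ → Subgroup (Q₀ ⧸ N), IsPrimeSeries K :=
    hK₀.exists_of_isSection (isSection_quotient N)
  refine ⟨Q₀ ⧸ N, inferInstance, inferInstance, hK.isMulTorsion, hji, hK.squarefree_orderOf,
    ⟨fun S _ hS => ?_, hK.residuallyFinite⟩, fun S _ hS _ => ?_, fun S _ hS _ => ?_⟩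
  all_goals obtain ⟨L, hL⟩ := hK.exists_of_isSection hS
  · exact hL.residuallyFinite
  · exact ⟨hL.isSolvable, fun p hp P a ha b hb => hL.commute_of_isPGroup hp P.isPGroup' ha hb⟩
  · exact hL.commute_of_isNilpotent
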